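/- Cayley's formula. Let $n\ge 1$ and let $\Pi_n$ be the complete graph on $n$ vertices, i.e. the graph in which every two distinct vertices are joined by exactly one edge and which has no loops. Let $\tau(\Pi_n)$ be the number of its spanning trees, i.e. of its connected acyclic subgraphs containing all $n$ vertices (the vertices being distinguishable). Number the vertices $1,\dots,n$ in any way, and let $K$ be the Kirchhoff minor of $\Pi_n$: the $(n-1)\times(n-1)$ matrix obtained by deleting the last row and the last column from the $n\times n$ matrix whose diagonal entries are the degrees of the vertices and whose off-diagonal entry in position $(i,j)$ is minus the number of edges joining the $i$-th and $j$-th vertices. Then $K$ has all diagonal entries equal to $n-1$ and all off-diagonal entries equal to $-1$, and \[ \tau(\Pi_n)=\det K=n^{n-2}. \] (For $n=1$ the matrix $K$ is empty, with determinant $1$, and $n^{n-2}=1^{-1}=1$.) -/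

import Mathlib

/-- The number `τ(G)` of spanning trees of `G`: the number of subgraphs of `G` on the whole vertex
set that are trees (connected and without cycles). -/
noncomputable def numSpanningTrees {V : Type*} (G : SimpleGraph V) : ℕ :=
  {T : SimpleGraph V | T ≤ G ∧ T.IsTree}.ncard

/-- The Kirchhoff minor of a graph whose vertices are numbered by `e`: the matrix with the degrees
of the vertices on the diagonal and the negated entries of the adjacency matrix off the diagonal,
with its last row and last column deleted. -/
def kirchhoffMinor {V : Type*} [Fintype V] [DecidableEq V] (G : SimpleGraph V)
    [DecidableRel G.Adj] {n : ℕ} (e : Fin n ≃ V) : Matrix (Fin (n - 1)) (Fin (n - 1)) ℤ :=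
  (G.lapMatrix ℤ).submatrix (fun i => e (i.castLE (Nat.sub_le n 1)))
    (fun j => e (j.castLE (Nat.sub_le n 1)))

/-! Orienting the edges of a spanning tree towards a root `r` identifies it with a parent function.
Replace row `r` of the Laplacian by a unit vector; every other row is a sum of `e_v - e_w` over the
neighbours `w` of `v`. By multilinearity the determinant is a sum over choices of one neighbour per
vertex, and a choice contributes 1 if it is a parent function and 0 otherwise. So the determinant
counts spanning trees, and it is also the Kirchhoff minor. For the complete graph the minor is `n I
- J` with `J` of rank one. -/

/-- `f` is a parent function rooted at `r`: it fixes `r`, and iterating it leads from every vertex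
to `r`. -/
structure IsParentFunction {V : Type*} (r : V) (f : V → V) : Prop where
  map_root : f r = r
  exists_iterate_eq : ∀ v, ∃ k, f^[k] v = r

/-- The graph joining every vertex to its image under `f`. -/
def parentGraph {V : Type*} (f : V → V) : SimpleGraph V :=
  SimpleGraph.fromRel fun u v => f u = v

theorem parentGraph_adj {V : Type*} {f : V → V} {u v : V} :
    (parentGraph f).Adj u v ↔ u ≠ v ∧ (f u = v ∨ f v = u) :=
  SimpleGraph.fromRel_adj _ _ _

namespace IsParentFunction

variable {V : Type*} {r : V} {f g : V → V}

theorem eq_root_of_map_eq_self (hf : IsParentFunction r f) {v : V} (hv : f v = v) : v = r := by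
  obtain ⟨k, hk⟩ := hf.exists_iterate_eq v
  rwa [Function.iterate_fixed hv] at hk

theorem eq_root_of_map_map_eq_self (hf : IsParentFunction r f) {v : V} (hv : f (f v) = v) :
    v = r := by
  have hit : ∀ k, f^[k] v = v ∨ f^[k] v = f v := by
    intro k
    induction k with
    | zero => exact Or.inl rfl
    | succ k ih =>
      rw [Function.iterate_succ_apply']
      rcases ih with h | h <;> rw [h]
      · exact Or.inr rfl
      · exact Or.inl hv
  obtain ⟨k, hk⟩ := hf.exists_iterate_eq v
  rcases hit k with h | h
  · exact h.symm.trans hk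
  · rw [hk] at h
    rw [← hv, ← h, hf.map_root]

theorem parentGraph_connected (hf : IsParentFunction r f) : (parentGraph f).Connected := by
  have hstep : ∀ v, (parentGraph f).Reachable v (f v) := by
    intro v
    by_cases h : v = f v
    · rw [← h]
    · exact (parentGraph_adj.2 ⟨h, Or.inl rfl⟩).reachable
  have hit : ∀ k v, (parentGraph f).Reachable v (f^[k] v) := by
    intro k
    induction k with
    | zero => exact fun v => SimpleGraph.Reachable.refl v
    | succ k ih => exact fun v => (hstep v).trans (ih (f v))
  have hroot : ∀ v, (parentGraph f).Reachable v r := by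
    intro v
    obtain ⟨k, hk⟩ := hf.exists_iterate_eq v
    exact hk ▸ hit k v
  have : Nonempty V := ⟨r⟩
  exact ⟨fun u v => (hroot u).trans (hroot v).symm⟩

/-- Every edge is `s(v, f v)` with `v ≠ r`, so the graph is connected with at most `|V| - 1` edges.
-/
theorem parentGraph_isTree [Finite V] (hf : IsParentFunction r f) : (parentGraph f).IsTree := by
  have hsub : (parentGraph f).edgeSet ⊆ (fun v => s(v, f v)) '' {v | v ≠ r} := by
    intro e
    induction e using Sym2.ind with
    | _ u v =>
      rw [SimpleGraph.mem_edgeSet, parentGraph_adj]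
      rintro ⟨hne, h | h⟩
      · refine ⟨u, ?_, congrArg (fun w => s(u, w)) h⟩
        rintro rfl
        exact hne (hf.map_root.symm.trans h)
      · refine ⟨v, ?_, (congrArg (fun w => s(v, w)) h).trans Sym2.eq_swap⟩
        rintro rfl
        exact hne (h.symm.trans hf.map_root)
  have hcard : (parentGraph f).edgeSet.ncard ≤ ({v | v ≠ r} : Set V).ncard :=
    (Set.ncard_le_ncard hsub (Set.toFinite _)).trans (Set.ncard_image_le (Set.toFinite _))
  have hcompl : ({v | v ≠ r} : Set V).ncard + 1 = Nat.card V := by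
    rw [← Set.ncard_singleton r, add_comm]
    exact Set.ncard_add_ncard_compl {r}
  have hconn := hf.parentGraph_connected
  have hle := hconn.card_vert_le_card_edgeSet_add_one
  rw [Nat.card_coe_set_eq] at hle
  rw [SimpleGraph.isTree_iff_connected_and_card, Nat.card_coe_set_eq]
  exact ⟨hconn, by omega⟩

theorem eq_of_parentGraph_eq (hf : IsParentFunction r f) (hg : IsParentFunction r g)
    (h : parentGraph f = parentGraph g) : f = g := by
  have key : ∀ k v, g^[k] v = r → f v = g v := by
    intro k
    induction k with
    | zero =>
      rintro v rfl
      exact hf.map_root.trans hg.map_root.symm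
    | succ k ih =>
      intro v hv
      have hw : f (g v) = g (g v) := ih (g v) hv
      by_cases hr : v = r
      · rw [hr, hf.map_root, hg.map_root]
      have hadj : (parentGraph f).Adj v (g v) := by
        rw [h, parentGraph_adj]
        exact ⟨fun e => hr (hg.eq_root_of_map_eq_self e.symm), Or.inl rfl⟩
      rcases (parentGraph_adj.1 hadj).2 with h1 | h1
      · exact h1
      -- The edge to `g v` would point the wrong way for `f`, giving `g` a 2-cycle away from the
      -- root.
      · exact absurd (hg.eq_root_of_map_map_eq_self (hw.symm.trans h1)) hr
  funext v
  obtain ⟨k, hk⟩ := hg.exists_iterate_eq v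
  exact key k v hk

end IsParentFunction

theorem SimpleGraph.Connected.exists_adj_dist_lt {V : Type*} {G : SimpleGraph V}
    (hG : G.Connected) {v r : V} (hv : v ≠ r) : ∃ w, G.Adj v w ∧ G.dist w r < G.dist v r := by
  obtain ⟨p, hp⟩ := hG.exists_walk_length_eq_dist v r
  cases p with
  | nil => exact absurd rfl hv
  | cons h q =>
    refine ⟨_, h, ?_⟩
    have := SimpleGraph.dist_le q
    rw [SimpleGraph.Walk.length_cons] at hp
    omega

theorem SimpleGraph.IsTree.exists_parentGraph_eq {V : Type*} {T : SimpleGraph V} (hT : T.IsTree)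
    (r : V) : ∃ f, IsParentFunction r f ∧ (∀ v, v ≠ r → T.Adj v (f v)) ∧ parentGraph f = T := by
  -- The parent of `v` is a neighbour strictly closer to `r`.
  have hex : ∀ v, ∃ w, (v = r → w = r) ∧ (v ≠ r → T.Adj v w ∧ T.dist w r < T.dist v r) := by
    intro v
    by_cases hv : v = r
    · exact ⟨r, fun _ => rfl, fun h => absurd hv h⟩
    · obtain ⟨w, hw⟩ := hT.connected.exists_adj_dist_lt hv
      exact ⟨w, fun h => absurd h hv, fun _ => hw⟩
  choose f hroot hf using hex
  have hreach : ∀ d v, T.dist v r ≤ d → ∃ k, f^[k] v = r := by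
    intro d
    induction d with
    | zero => exact fun v hv => ⟨0, hT.connected.dist_eq_zero_iff.1 (Nat.le_zero.1 hv)⟩
    | succ d ih =>
      intro v hv
      by_cases h : v = r
      · exact ⟨0, h⟩
      · obtain ⟨k, hk⟩ := ih (f v) (by have := (hf v h).2; omega)
        exact ⟨k + 1, hk⟩
  have hpar : IsParentFunction r f := ⟨hroot r rfl, fun v => hreach _ v le_rfl⟩
  have hle : parentGraph f ≤ T := by
    have hstep : ∀ u v, u ≠ v → f u = v → T.Adj u v := by
      rintro u v hne rfl
      exact (hf u fun h => hne (by rw [hroot u h, h])).1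
    intro u v huv
    obtain ⟨hne, h | h⟩ := parentGraph_adj.1 huv
    · exact hstep u v hne h
    · exact (hstep v u hne.symm h).symm
  exact ⟨f, hpar, fun v hv => (hf v hv).1,
    le_antisymm hle ((SimpleGraph.isTree_iff_minimal_connected.1 hT).2
      hpar.parentGraph_connected hle)⟩

theorem numSpanningTrees_eq_ncard_parentFunctions {V : Type*} [Finite V] (G : SimpleGraph V)
    (r : V) : numSpanningTrees G =
      {f : V → V | (∀ v, v ≠ r → G.Adj v (f v)) ∧ IsParentFunction r f}.ncard := by
  symm
  refine Set.ncard_congr (fun f _ => parentGraph f) ?_ ?_ ?_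
  · rintro f ⟨hadj, hf⟩
    refine ⟨?_, hf.parentGraph_isTree⟩
    have hstep : ∀ u v, u ≠ v → f u = v → G.Adj u v := by
      rintro u v hne rfl
      exact hadj u fun h => hne (by rw [h, hf.map_root])
    intro u v huv
    obtain ⟨hne, h | h⟩ := parentGraph_adj.1 huv
    · exact hstep u v hne h
    · exact (hstep v u hne.symm h).symm
  · exact fun f g hf hg h => hf.2.eq_of_parentGraph_eq hg.2 h
  · rintro T ⟨hle, hT⟩
    obtain ⟨f, hf, hadj, rfl⟩ := hT.exists_parentGraph_eq r
    exact ⟨f, ⟨fun v hv => hle (hadj v hv), hf⟩, rfl⟩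

/-- The matrix whose row at `v ≠ r` is the difference of the unit vectors at `v` and `f v`, and
whose row at `r` is the unit vector at `r`. -/
def parentMatrix {V : Type*} [DecidableEq V] (r : V) (f : V → V) : Matrix V V ℤ :=
  fun v => Pi.single v 1 - if v = r then 0 else Pi.single (f v) 1

theorem parentMatrix_apply {V : Type*} [DecidableEq V] (r : V) (f : V → V) (v w : V) :
    parentMatrix r f v w = (if v = w then 1 else 0) - if v ≠ r ∧ f v = w then 1 else 0 := by
  by_cases hv : v = r <;> simp [parentMatrix, hv, Pi.single_apply, eq_comm]

theorem parentMatrix_mulVec {V : Type*} [Fintype V] [DecidableEq V] (r : V) (f : V → V)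
    (x : V → ℤ) (v : V) :
    (parentMatrix r f).mulVec x v = x v - if v = r then 0 else x (f v) := by
  by_cases hv : v = r <;>
    simp [Matrix.mulVec, dotProduct, parentMatrix_apply, hv, sub_mul, Finset.sum_sub_distrib]

/-- Grading vertices by depth `b` makes the transpose block triangular with identity blocks. -/
theorem IsParentFunction.det_parentMatrix {V : Type*} [Fintype V] [DecidableEq V] {r : V}
    {f : V → V} (hf : IsParentFunction r f) : (parentMatrix r f).det = 1 := by
  classical
  let b : V → ℕ := fun v => Nat.find (hf.exists_iterate_eq v)
  have hb : ∀ v, v ≠ r → b (f v) < b v := by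
    intro v hv
    have hspec : f^[b v] v = r := Nat.find_spec (hf.exists_iterate_eq v)
    have hmin : ∀ k, f^[k] (f v) = r → b (f v) ≤ k :=
      fun k hk => Nat.find_min' (hf.exists_iterate_eq (f v)) hk
    cases hk : b v with
    | zero => rw [hk] at hspec; exact absurd hspec hv
    | succ k => rw [hk] at hspec; exact Nat.lt_succ_of_le (hmin k hspec)
  have htri : (parentMatrix r f).transpose.BlockTriangular b := by
    intro w v hvw
    have hne : v ≠ w := fun h => hvw.ne (congrArg b h)
    have hne' : ¬ (v ≠ r ∧ f v = w) := by
      rintro ⟨hv, rfl⟩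
      exact hvw.not_gt (hb v hv)
    rw [Matrix.transpose_apply, parentMatrix_apply, if_neg hne, if_neg hne', sub_zero]
  rw [← Matrix.det_transpose, htri.det]
  refine Finset.prod_eq_one fun k _ => ?_
  have hblock : (parentMatrix r f).transpose.toSquareBlock b k = 1 := by
    ext ⟨w, hw⟩ ⟨v, hv⟩
    have hne : ¬ (v ≠ r ∧ f v = w) := by
      rintro ⟨hvr, rfl⟩
      exact (hb v hvr).ne (hw.trans hv.symm)
    rw [Matrix.toSquareBlock_def, Matrix.of_apply, Matrix.transpose_apply, parentMatrix_apply,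
      if_neg hne, sub_zero, Matrix.one_apply]
    simp only [Subtype.mk.injEq, eq_comm]
  rw [hblock, Matrix.det_one]

/-- The indicator of the vertices that never reach `r` is a nonzero kernel vector. -/
theorem det_parentMatrix_eq_zero {V : Type*} [Fintype V] [DecidableEq V] {r : V} {f : V → V}
    (hr : f r = r) (hf : ¬ IsParentFunction r f) : (parentMatrix r f).det = 0 := by
  classical
  have hv : ∃ v, ¬ ∃ k, f^[k] v = r := by
    by_contra! h
    exact hf ⟨hr, h⟩
  obtain ⟨v, hv⟩ := hv
  rw [← Matrix.exists_mulVec_eq_zero_iff]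
  refine ⟨fun w => if ∃ k, f^[k] w = r then 0 else 1, fun h => ?_, ?_⟩
  · have := congrFun h v
    simp [hv] at this
  · funext w
    rw [parentMatrix_mulVec]
    by_cases hw : w = r
    · rw [if_pos (⟨0, hw⟩ : ∃ k, f^[k] w = r), if_pos hw]
      rfl
    · have : (∃ k, f^[k] w = r) ↔ ∃ k, f^[k] (f w) = r := by
        constructor
        · rintro ⟨k, hk⟩
          cases k with
          | zero => exact absurd hk hw
          | succ k => exact ⟨k, hk⟩
        · rintro ⟨k, hk⟩
          exact ⟨k + 1, hk⟩
      simp [hw, this]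

/-- The matrix-tree theorem for the Laplacian with the row of `r` replaced by the unit vector. -/
theorem numSpanningTrees_eq_det_updateRow {V : Type*} [Fintype V] [DecidableEq V]
    (G : SimpleGraph V) [DecidableRel G.Adj] (r : V) :
    (numSpanningTrees G : ℤ) = ((G.lapMatrix ℤ).updateRow r (Pi.single r 1)).det := by
  classical
  let A : V → Finset V := fun v => if v = r then {r} else G.neighborFinset v
  have hrows : (G.lapMatrix ℤ).updateRow r (Pi.single r 1) = fun v =>
      ∑ w ∈ A v, ((Pi.single v 1 : V → ℤ) - if v = r then 0 else Pi.single w 1) := by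
    funext v
    by_cases hv : v = r
    · subst hv
      simp [A]
    · funext w
      simp [A, hv, SimpleGraph.lapMatrix, SimpleGraph.degMatrix, Matrix.diagonal_apply,
        Pi.single_apply, SimpleGraph.adjMatrix_apply, eq_comm (a := w)]
  have hdet : ((G.lapMatrix ℤ).updateRow r (Pi.single r 1)).det =
      ∑ f ∈ Fintype.piFinset A, (parentMatrix r f).det := by
    rw [hrows]
    exact (Matrix.detRowAlternating (R := ℤ) (n := V)).toMultilinearMap.map_sum_finset _ A
  have hmem : ∀ f, f ∈ Fintype.piFinset A ↔ f r = r ∧ ∀ v, v ≠ r → G.Adj v (f v) := by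
    intro f
    rw [Fintype.mem_piFinset]
    constructor
    · intro h
      exact ⟨by simpa [A] using h r, fun v hv => by simpa [A, hv] using h v⟩
    · rintro ⟨h1, h2⟩ v
      by_cases hv : v = r
      · simp [A, hv, h1]
      · simpa [A, hv] using h2 v hv
  have hval : ∀ f ∈ Fintype.piFinset A,
      (parentMatrix r f).det = if IsParentFunction r f then 1 else 0 := by
    intro f hf
    split_ifs with h
    · exact h.det_parentMatrix
    · exact det_parentMatrix_eq_zero ((hmem f).1 hf).1 h
  rw [hdet, Finset.sum_congr rfl hval, Finset.sum_boole, Nat.cast_inj,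
    numSpanningTrees_eq_ncard_parentFunctions G r, ← Set.ncard_coe_finset]
  congr 1
  ext f
  simp only [Set.mem_ofPred_eq, Finset.coe_filter, hmem]
  exact ⟨fun h => ⟨⟨h.2.map_root, h.1⟩, h.2⟩, fun h => ⟨h.1.2, h.2⟩⟩

/-- The matrix-tree theorem. -/
theorem numSpanningTrees_eq_det_kirchhoffMinor {V : Type*} [Fintype V] [DecidableEq V]
    (G : SimpleGraph V) [DecidableRel G.Adj] {n : ℕ} (hn : 1 ≤ n) (e : Fin n ≃ V) :
    (numSpanningTrees G : ℤ) = (kirchhoffMinor G e).det := by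
  obtain ⟨m, rfl⟩ := Nat.exists_eq_add_of_le' hn
  have hminor : kirchhoffMinor G e = ((G.lapMatrix ℤ).submatrix e e).submatrix
      (Fin.last m).succAbove (Fin.last m).succAbove := by
    rw [Fin.succAbove_last]
    rfl
  have hrow : ((G.lapMatrix ℤ).submatrix e e).updateRow (Fin.last m) (Pi.single (Fin.last m) 1) =
      ((G.lapMatrix ℤ).updateRow (e (Fin.last m)) (Pi.single (e (Fin.last m)) 1)).submatrix e e := by
    ext i j
    by_cases hi : i = Fin.last m
    · subst hi
      simp [Pi.single_apply]
    · simp [Matrix.updateRow_apply, hi]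
  -- A diagonal adjugate entry is both the minor and the determinant with that row made a unit
  -- vector.
  have hadj := Matrix.adjugate_fin_succ_eq_det_submatrix
    ((G.lapMatrix ℤ).submatrix e e) (Fin.last m) (Fin.last m)
  rw [Even.neg_one_pow ⟨_, rfl⟩, one_mul, Matrix.adjugate_apply, hrow,
    Matrix.det_submatrix_equiv_self] at hadj
  rw [hminor, ← hadj]
  exact numSpanningTrees_eq_det_updateRow G _

theorem kirchhoffMinor_top {V : Type*} [Fintype V] [DecidableEq V] {n : ℕ} (e : Fin n ≃ V) :
    kirchhoffMinor (⊤ : SimpleGraph V) e =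
      Matrix.of (fun i j => if i = j then (n : ℤ) - 1 else -1) := by
  ext i j
  have hcard : Fintype.card V = n := by rw [← Fintype.card_congr e, Fintype.card_fin]
  have hn : 1 ≤ n := by have := i.2; omega
  by_cases h : i = j
  · subst h
    simp [kirchhoffMinor, SimpleGraph.lapMatrix, SimpleGraph.degMatrix, hcard, hn]
  · simp [kirchhoffMinor, SimpleGraph.lapMatrix, SimpleGraph.degMatrix, h]

theorem det_kirchhoffMinor_top {V : Type*} [Fintype V] [DecidableEq V] {n : ℕ} (hn : 1 ≤ n)
    (e : Fin n ≃ V) :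
    ((kirchhoffMinor (⊤ : SimpleGraph V) e).det : ℚ) = (n : ℚ) ^ ((n : ℤ) - 2) := by
  obtain ⟨m, rfl⟩ := Nat.exists_eq_add_of_le' hn
  have hshape : kirchhoffMinor (⊤ : SimpleGraph V) e =
      Matrix.scalar _ ((m + 1 : ℕ) : ℤ) - Matrix.vecMulVec 1 1 := by
    rw [kirchhoffMinor_top]
    ext i j
    rw [Matrix.sub_apply, Matrix.scalar_apply, Matrix.diagonal_apply, Matrix.vecMulVec_apply,
      Matrix.of_apply]
    split_ifs <;> simp
  -- This is the characteristic polynomial of `J` at `m + 1`; for `m = 0` the truncated exponent is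
  -- harmless, as its factor `m` vanishes.
  have hdet : (kirchhoffMinor (⊤ : SimpleGraph V) e).det =
      ((m + 1 : ℕ) : ℤ) ^ m - m * ((m + 1 : ℕ) : ℤ) ^ (m - 1) := by
    rw [hshape, ← Matrix.eval_charpoly, Matrix.charpoly_vecMulVec]
    simp
  rw [hdet]
  cases m with
  | zero => simp
  | succ k =>
    have hexp : ((k + 1 + 1 : ℕ) : ℤ) - 2 = (k : ℤ) := by push_cast; ring
    rw [hexp, zpow_natCast, Nat.add_sub_cancel]
    push_cast
    ring

theorem mainTheorem3 {V : Type*} [Fintype V] [DecidableEq V] (n : ℕ) (hn : 1 ≤ n)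
    (e : Fin n ≃ V) :
    kirchhoffMinor (⊤ : SimpleGraph V) e
        = Matrix.of (fun i j => if i = j then (n : ℤ) - 1 else -1) ∧
      (numSpanningTrees (⊤ : SimpleGraph V) : ℤ) = (kirchhoffMinor (⊤ : SimpleGraph V) e).det ∧
      ((kirchhoffMinor (⊤ : SimpleGraph V) e).det : ℚ) = (n : ℚ) ^ ((n : ℤ) - 2) ∧
      (numSpanningTrees (⊤ : SimpleGraph V) : ℚ) = (n : ℚ) ^ ((n : ℤ) - 2) := by
  have htop := kirchhoffMinor_top e
  have htree := numSpanningTrees_eq_det_kirchhoffMinor (⊤ : SimpleGraph V) hn e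
  have hdet := det_kirchhoffMinor_top hn e
  exact ⟨htop, htree, hdet, by rw [← hdet, ← htree, Int.cast_natCast]⟩
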